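/- Let $l\ge 1$ and $\mathbf k\in(\mathbb N\cup\{\infty\})^l$. Order $\mathbb N^l$ and $(\mathbb N\cup\{\infty\})^l$ componentwise, and let $|\mathbf n|$ be the sum of the coordinates of $\mathbf n\in\mathbb N^l$. A vector composition $\mathbf I=(\mathbf i_1,\dots,\mathbf i_m)$ is a finite (possibly empty) sequence of nonzero elements of $\mathbb N^l$, called its columns, and $\ell(\mathbf I)=m$. Write $\mathbf J\trianglelefteq\mathbf I$ if $\mathbf J$ is obtained from $\mathbf I$ by summing blocks of consecutive columns. Let $\mathrm{QSym}^{(l)}$ be the $\mathbb N^l$-graded Hopf algebra over $\mathbb Q$ of quasisymmetric functions of level $l$, that is, of power series of bounded degree in commuting variables $x_j^{(c)}$ ($j\ge1$, $0\le c<l$) spanned by the monomial functions $M_{\mathbf I}=\sum_{j_1<\cdots<j_m}\mathbf x_{j_1}^{\mathbf i_1}\cdots\mathbf x_{j_m}^{\mathbf i_m}$, where $\mathbf x_j^{\mathbf n}=\prod_c (x_j^{(c)})^{n_c}$, graded by multidegree and with coproduct $\Delta(M_{\mathbf I})=\sum_{\mathbf I=\mathbf J\mathbf K}M_{\mathbf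 J}\otimes M_{\mathbf K}$ (sum over all ways to cut $\mathbf I$ into two possibly empty parts). Let $\mathrm{NSym}^{(l)}=\bigoplus_{\mathbf n}(\mathrm{QSym}^{(l)}_{\mathbf n})^*$ be its graded dual with the convolution product. Let $\zeta$ be the universal character: $\zeta(M_{\mathbf I})=1$ if $\ell(\mathbf I)\le1$, and $\zeta(M_{\mathbf I})=0$ otherwise. Let $\zeta^{-1}$ be its convolution inverse, and let $\bar\zeta$ be the functional equal to $(-1)^{|\mathbf n|}\zeta$ in degree $\mathbf n$. For a functional $\phi$ let $\phi_{\mathbf n}\in\mathrm{NSym}^{(l)}$ be its component of degree $\mathbf n$. The $\mathbf k$-odd Hopf ideal $\mathcal I\mathcal O^{\mathbf k}$ is the two-sided ideal of $\mathrm{NSym}^{(l)}$ generated by all $\bar\zeta_{\mathbf n}-(\zeta^{-1})_{\mathbf n}$ with $\mathbf n\in\mathbb N^l$, $\mathbf n\le\mathbf k$. The $\mathbf k$-odd Hopf subalgebra $\mathcal O^{\mathbf k}$ is the largest graded subcoalgebra $C$ of $\mathrm{QSym}^{(l)}$ such that $\bar\zeta(h)=\zeta^{-1}(h)$ for all $h\in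 C\cap\bigoplus_{\mathbf n\le\mathbf k}\mathrm{QSym}^{(l)}_{\mathbf n}$. Put $\eta_{\mathbf I}=\sum_{\mathbf J\trianglelefteq\mathbf I}2^{\ell(\mathbf J)}M_{\mathbf J}$; these form a basis of $\mathrm{QSym}^{(l)}$. Let $(\Upsilon^{\mathbf I})$ be the dual basis of $\mathrm{NSym}^{(l)}$, so $\Upsilon^{\mathbf I}(\eta_{\mathbf J})=\delta_{\mathbf I,\mathbf J}$, and let $\Upsilon_{\mathbf n}=\Upsilon^{(\mathbf n)}$ for $\mathbf n\ne\mathbf 0$ (the case of a single column). Theorem. As a two-sided ideal, $$\mathcal I\mathcal O^{\mathbf k}=\big\langle\,\Upsilon_{\mathbf n}\;\big|\;\mathbf 0<\mathbf n\le\mathbf k,\ |\mathbf n|\text{ even}\,\big\rangle,$$ and $$\mathcal O^{\mathbf k}=\mathrm{span}_{\mathbb Q}\{\,\eta_{(\mathbf i_1,\dots,\mathbf i_m)}\;|\;\text{for every } r,\ \mathbf i_r\le\mathbf k\text{ implies that }|\mathbf i_r|\text{ is odd}\,\}.$$ -/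

import Mathlib

/-! ## Multigraded coalgebras, their graded duals and the ideals and subcoalgebras `I^k`, `S_k` -/

noncomputable section

namespace Multigraded

set_option linter.unusedSectionVars false

open Coalgebra TensorProduct WithConv

/-- The weight of an `l`-partite number: the sum of its coordinates. -/
def weight {l : ℕ} (n : Fin l → ℕ) : ℕ := ∑ i, n i

/-- The componentwise order `n ≤ k` for `n ∈ ℕ^l` and `k ∈ (ℕ ∪ {∞})^l`. -/
def LeExt {l : ℕ} (n : Fin l → ℕ) (k : Fin l → ℕ∞) : Prop := ∀ i, (n i : ℕ∞) ≤ k i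

section General

variable {l : ℕ} {H : Type*} [AddCommGroup H] [Module ℚ H] [Coalgebra ℚ H]
variable (𝒜 : (Fin l → ℕ) → Submodule ℚ H)

/-- The grading `H = ⨁ 𝒜 n` is compatible with the coalgebra structure:
`Δ(𝒜 n) ⊆ ⨁_{p + q = n} 𝒜 p ⊗ 𝒜 q`, and the counit vanishes on `𝒜 n` for `n ≠ 0`. -/
class IsGradedCoalgebra : Prop where
  comul_mem : ∀ n, ∀ h ∈ 𝒜 n, comul (R := ℚ) h ∈
    ⨆ (p : (Fin l → ℕ) × (Fin l → ℕ)) (_ : p.1 + p.2 = n),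
      LinearMap.range (TensorProduct.map (𝒜 p.1).subtype (𝒜 p.2).subtype)
  counit_eq_zero : ∀ n, n ≠ 0 → ∀ h ∈ 𝒜 n, counit (R := ℚ) h = 0

theorem conv_apply_ne_zero [IsGradedCoalgebra 𝒜] (f g : WithConv (H →ₗ[ℚ] ℚ))
    (n : Fin l → ℕ) (h : H) (hh : h ∈ 𝒜 n) (hne : (f * g) h ≠ 0) :
    ∃ p q, p + q = n ∧ (∃ x ∈ 𝒜 p, f x ≠ 0) ∧ (∃ y ∈ 𝒜 q, g y ≠ 0) := by
  by_contra hcon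
  apply hne
  rw [LinearMap.convMul_apply]
  have key : (⨆ (p : (Fin l → ℕ) × (Fin l → ℕ)) (_ : p.1 + p.2 = n),
      LinearMap.range (TensorProduct.map (𝒜 p.1).subtype (𝒜 p.2).subtype)) ≤
      LinearMap.ker (LinearMap.mul' ℚ ℚ ∘ₗ TensorProduct.map f.ofConv g.ofConv) := by
    refine iSup₂_le fun p hp => ?_
    rintro _ ⟨t, rfl⟩
    rw [LinearMap.mem_ker]
    induction t with
    | zero => simp
    | add a b ha hb => rw [map_add, map_add, ha, hb, add_zero]
    | tmul x y =>
      by_contra hxy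
      apply hcon
      refine ⟨p.1, p.2, hp, ⟨x, x.2, ?_⟩, ⟨y, y.2, ?_⟩⟩
      · intro h0
        apply hxy
        simp [h0]
      · intro h0
        apply hxy
        simp [h0]
  exact key (IsGradedCoalgebra.comul_mem n h hh)

/-- The (multi)graded dual `H^* = ⨁ (H_n)^*` of a graded coalgebra `H`: the functionals which
vanish on all but finitely many homogeneous components, with the convolution product. -/
def gradedDual [IsGradedCoalgebra 𝒜] : Subalgebra ℚ (WithConv (H →ₗ[ℚ] ℚ)) where
  carrier := {f | {n | ∃ h ∈ 𝒜 n, f h ≠ 0}.Finite}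
  mul_mem' {f g} hf hg := by
    refine (hf.add hg).subset ?_
    rintro n ⟨h, hh, hne⟩
    obtain ⟨p, q, hpq, hp, hq⟩ := conv_apply_ne_zero 𝒜 f g n h hh hne
    exact ⟨p, hp, q, hq, hpq⟩
  add_mem' {f g} hf hg := by
    refine (hf.union hg).subset ?_
    rintro n ⟨h, hh, hne⟩
    by_contra hcon
    rw [Set.mem_union, not_or] at hcon
    apply hne
    have h1 : f h = 0 := by
      by_contra h1
      exact hcon.1 ⟨h, hh, h1⟩
    have h2 : g h = 0 := by
      by_contra h2
      exact hcon.2 ⟨h, hh, h2⟩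
    simp [h1, h2]
  algebraMap_mem' r := by
    refine (Set.finite_singleton (0 : Fin l → ℕ)).subset ?_
    rintro n ⟨h, hh, hne⟩
    by_contra hn
    apply hne
    rw [LinearMap.convAlgebraMap_apply, IsGradedCoalgebra.counit_eq_zero n hn h hh]
    simp

variable [DirectSum.Decomposition 𝒜]

/-- The projection of `H` onto its homogeneous component of degree `n`. -/
def proj (n : Fin l → ℕ) : H →ₗ[ℚ] H :=
  (𝒜 n).subtype ∘ₗ DirectSum.component ℚ (Fin l → ℕ) (fun m => 𝒜 m) n ∘ₗ
    (DirectSum.decomposeLinearEquiv 𝒜).toLinearMap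

theorem proj_apply (n : Fin l → ℕ) (h : H) :
    proj 𝒜 n h = (DirectSum.decompose 𝒜 h n : H) := rfl

theorem proj_same {n : Fin l → ℕ} {h : H} (hh : h ∈ 𝒜 n) : proj 𝒜 n h = h := by
  rw [proj_apply, DirectSum.decompose_of_mem_same 𝒜 hh]

theorem proj_ne {m n : Fin l → ℕ} {h : H} (hh : h ∈ 𝒜 m) (hmn : m ≠ n) :
    proj 𝒜 n h = 0 := by
  rw [proj_apply, DirectSum.decompose_of_mem_ne 𝒜 hh hmn]

/-- The functional `φ̄`, which is `(-1)^|n| φ` on the component of degree `n`. -/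
def bar (φ : WithConv (H →ₗ[ℚ] ℚ)) : WithConv (H →ₗ[ℚ] ℚ) :=
  toConv ((DirectSum.toModule ℚ (Fin l → ℕ) ℚ
      fun n => (-1 : ℚ) ^ weight n • (φ.ofConv ∘ₗ (𝒜 n).subtype)) ∘ₗ
    (DirectSum.decomposeLinearEquiv 𝒜).toLinearMap)

theorem bar_apply (φ : WithConv (H →ₗ[ℚ] ℚ)) {n : Fin l → ℕ} {h : H} (hh : h ∈ 𝒜 n) :
    bar 𝒜 φ h = (-1 : ℚ) ^ weight n * φ h := by
  have := DirectSum.decomposeLinearEquiv_apply_coe (R := ℚ) (ℳ := 𝒜) n ⟨h, hh⟩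
  simp only at this
  simp [bar, this]

/-- The homogeneous component `φ_n` of a functional `φ`: it is `φ` on `H_n` and zero on the other
components. It is an element of the graded dual. -/
def component [IsGradedCoalgebra 𝒜] (φ : WithConv (H →ₗ[ℚ] ℚ)) (n : Fin l → ℕ) :
    gradedDual 𝒜 :=
  ⟨toConv (φ.ofConv ∘ₗ proj 𝒜 n), by
    refine (Set.finite_singleton n).subset ?_
    rintro m ⟨h, hh, hne⟩
    by_contra hm
    apply hne
    simp [proj_ne 𝒜 hh hm]⟩

/-- Graded subcoalgebras: homogeneous subspaces `C` with `Δ(C) ⊆ C ⊗ C`. -/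
structure IsGradedSubcoalgebra (C : Submodule ℚ H) : Prop where
  homogeneous : DirectSum.SetLike.IsHomogeneous 𝒜 C
  comul_mem : ∀ h ∈ C, comul (R := ℚ) h ∈
    LinearMap.range (TensorProduct.map C.subtype C.subtype)

/-- `⨁_{n ≤ k} H_n`. -/
def initialPart (k : Fin l → ℕ∞) : Submodule ℚ H := ⨆ (n : Fin l → ℕ) (_ : LeExt n k), 𝒜 n

/-- The graded subcoalgebras on whose `k`-initial part `φ` and `ψ` agree. -/
def agreeing (k : Fin l → ℕ∞) (φ ψ : WithConv (H →ₗ[ℚ] ℚ)) : Set (Submodule ℚ H) :=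
  {C | IsGradedSubcoalgebra 𝒜 C ∧ ∀ h ∈ C ⊓ initialPart 𝒜 k, φ h = ψ h}

/-- `S_k(φ, ψ)`: the largest graded subcoalgebra on whose `k`-initial part `φ` and `ψ` agree;
see `isGreatest_agreeSubcoalgebra`. -/
def agreeSubcoalgebra (k : Fin l → ℕ∞) (φ ψ : WithConv (H →ₗ[ℚ] ℚ)) : Submodule ℚ H :=
  sSup (agreeing 𝒜 k φ ψ)

theorem isGreatest_agreeSubcoalgebra (k : Fin l → ℕ∞) (φ ψ : WithConv (H →ₗ[ℚ] ℚ)) :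
    IsGreatest (agreeing 𝒜 k φ ψ) (agreeSubcoalgebra 𝒜 k φ ψ) := by
  classical
  refine ⟨⟨⟨?_, ?_⟩, ?_⟩, fun C hC => le_sSup hC⟩
  · intro n h hh
    have : agreeSubcoalgebra 𝒜 k φ ψ ≤ (agreeSubcoalgebra 𝒜 k φ ψ).comap (proj 𝒜 n) :=
      sSup_le fun C hC x hx => (le_sSup hC : C ≤ _) (hC.1.homogeneous n hx)
    exact this hh
  · intro h hh
    have : agreeSubcoalgebra 𝒜 k φ ψ ≤ (LinearMap.range (TensorProduct.map
        (agreeSubcoalgebra 𝒜 k φ ψ).subtype (agreeSubcoalgebra 𝒜 k φ ψ).subtype)).comap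
          (comul (R := ℚ)) := by
      refine sSup_le fun C hC x hx => ?_
      have hle : C ≤ agreeSubcoalgebra 𝒜 k φ ψ := le_sSup hC
      obtain ⟨t, ht⟩ := hC.1.comul_mem x hx
      refine ⟨TensorProduct.map (Submodule.inclusion hle) (Submodule.inclusion hle) t, ?_⟩
      rw [← ht, ← LinearMap.comp_apply, ← TensorProduct.map_comp]
      rfl
    exact this hh
  · rintro h ⟨hh, hk⟩
    have h1 : ∀ n, LeExt n k → φ (proj 𝒜 n h) = ψ (proj 𝒜 n h) := by
      intro n hn
      have : agreeSubcoalgebra 𝒜 k φ ψ ≤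
          LinearMap.ker ((φ.ofConv - ψ.ofConv) ∘ₗ proj 𝒜 n) := by
        refine sSup_le fun C hC x hx => ?_
        rw [LinearMap.mem_ker, LinearMap.comp_apply, LinearMap.sub_apply, sub_eq_zero]
        refine hC.2 _ ⟨hC.1.homogeneous n hx, ?_⟩
        exact (le_iSup₂_of_le n hn le_rfl : 𝒜 n ≤ initialPart 𝒜 k) (Subtype.mem _)
      have := this hh
      rwa [LinearMap.mem_ker, LinearMap.comp_apply, LinearMap.sub_apply, sub_eq_zero] at this
    have h2 : ∀ n, ¬ LeExt n k → proj 𝒜 n h = 0 := by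
      intro n hn
      have : initialPart 𝒜 k ≤ LinearMap.ker (proj 𝒜 n) := by
        refine iSup₂_le fun m hm x hx => proj_ne 𝒜 hx ?_
        rintro rfl
        exact hn hm
      exact this hk
    rw [← DirectSum.sum_support_decompose 𝒜 h, map_sum, map_sum]
    refine Finset.sum_congr rfl fun n _ => ?_
    by_cases hn : LeExt n k
    · exact h1 n hn
    · have := h2 n hn
      rw [proj_apply] at this
      rw [this, map_zero, map_zero]

/-- `I^k(φ, ψ)`: the two-sided ideal of the graded dual generated by the `φ_n - ψ_n`, `n ≤ k`. -/
def agreeIdeal [IsGradedCoalgebra 𝒜] (k : Fin l → ℕ∞) (φ ψ : WithConv (H →ₗ[ℚ] ℚ)) :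
    TwoSidedIdeal (gradedDual 𝒜) :=
  TwoSidedIdeal.span {x | ∃ n, LeExt n k ∧ x = component 𝒜 φ n - component 𝒜 ψ n}

/-- The `k`-odd Hopf subalgebra `S_k(φ̄, φ⁻¹)` attached to a convolution invertible functional. -/
def oddSubalgebra (k : Fin l → ℕ∞) (φ : (WithConv (H →ₗ[ℚ] ℚ))ˣ) : Submodule ℚ H :=
  agreeSubcoalgebra 𝒜 k (bar 𝒜 φ) (↑φ⁻¹ : WithConv (H →ₗ[ℚ] ℚ))

/-- The `k`-odd Hopf ideal `I^k(φ̄, φ⁻¹)` attached to a convolution invertible functional. -/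
def oddIdeal [IsGradedCoalgebra 𝒜] (k : Fin l → ℕ∞) (φ : (WithConv (H →ₗ[ℚ] ℚ))ˣ) :
    TwoSidedIdeal (gradedDual 𝒜) :=
  agreeIdeal 𝒜 k (bar 𝒜 φ) (↑φ⁻¹ : WithConv (H →ₗ[ℚ] ℚ))

end General

end Multigraded

end

/-! ## Quasisymmetric functions of level `l` -/

noncomputable section

namespace LevelQSym

open Coalgebra TensorProduct WithConv Multigraded

/-- Vector compositions: finite sequences of nonzero `l`-partite numbers (the columns). -/
abbrev VecComp (l : ℕ) := List {n : Fin l → ℕ // n ≠ 0}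

variable {l : ℕ}

/-- `Σ I`, the sum of the columns of `I`. -/
def colSum (I : VecComp l) : Fin l → ℕ := (I.map Subtype.val).sum

/-- `I ⊴ J`: the vector composition `J` is a refinement of `I = (i_1, …, i_m)`, i.e. `J` is a
concatenation `J_1 ⋯ J_m` where `J_r` is a vector composition of `i_r`. -/
def Refines (I J : VecComp l) : Prop :=
  ∃ L : List (VecComp l), L.flatten = J ∧ L.map colSum = I.map Subtype.val

/-- The exponent of the monomial `x_{j_1}^{i_1} ⋯ x_{j_m}^{i_m}`. The variable `x_j^{(c)}` has
index `(j, c)`. -/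
def mon (I : VecComp l) (j : Fin I.length → ℕ) : (ℕ × Fin l) →₀ ℕ :=
  ∑ r, ∑ c, Finsupp.single (j r, c) ((I.get r).1 c)

/-- The multidegree of a monomial. -/
def mdeg (d : (ℕ × Fin l) →₀ ℕ) : Fin l → ℕ := d.sum fun a e => Pi.single a.2 e

variable (l) in
/-- The space of quasisymmetric functions of level `l`: power series `f` of bounded degree such
that the coefficients of `x_{j_1}^{i_1} ⋯ x_{j_m}^{i_m}` and `x_1^{i_1} ⋯ x_m^{i_m}` in `f` agree
for all vector compositions `(i_1, …, i_m)` and all `j_1 < ⋯ < j_m`. (The variables are numbered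
from zero.) -/
def QSym : Submodule ℚ (MvPowerSeries (ℕ × Fin l) ℚ) where
  carrier := {f | (∃ N : ℕ, ∀ d, MvPowerSeries.coeff d f ≠ 0 → d.degree ≤ N) ∧
    ∀ (I : VecComp l) (j : Fin I.length → ℕ), StrictMono j →
      MvPowerSeries.coeff (mon I j) f = MvPowerSeries.coeff (mon I fun r => r.val) f}
  add_mem' {f g} hf hg := by
    obtain ⟨⟨N, hN⟩, hf⟩ := hf
    obtain ⟨⟨M, hM⟩, hg⟩ := hg
    refine ⟨⟨max N M, fun d hd => ?_⟩, fun I j hj => ?_⟩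
    · by_contra hcon
      apply hd
      have h1 : MvPowerSeries.coeff d f = 0 := by
        by_contra h
        exact hcon ((hN d h).trans (le_max_left _ _))
      have h2 : MvPowerSeries.coeff d g = 0 := by
        by_contra h
        exact hcon ((hM d h).trans (le_max_right _ _))
      rw [map_add, h1, h2, add_zero]
    · rw [map_add, map_add, hf I j hj, hg I j hj]
  zero_mem' := ⟨⟨0, fun d hd => absurd (map_zero _) hd⟩, fun I j hj => by simp⟩
  smul_mem' c f hf := by
    obtain ⟨⟨N, hN⟩, hf⟩ := hf
    refine ⟨⟨N, fun d hd => hN d fun h => hd ?_⟩, fun I j hj => ?_⟩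
    · rw [map_smul, h, smul_zero]
    · rw [map_smul, map_smul, hf I j hj]

variable (l) in
/-- The homogeneous component `QSym_n`. -/
def component (n : Fin l → ℕ) : Submodule ℚ (QSym l) where
  carrier := {f | ∀ d, MvPowerSeries.coeff d f.1 ≠ 0 → mdeg d = n}
  add_mem' {f g} hf hg d hd := by
    by_contra hcon
    apply hd
    have h1 : MvPowerSeries.coeff d f.1 = 0 := by
      by_contra h
      exact hcon (hf d h)
    have h2 : MvPowerSeries.coeff d g.1 = 0 := by
      by_contra h
      exact hcon (hg d h)
    rw [Submodule.coe_add, map_add, h1, h2, add_zero]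
  zero_mem' d hd := absurd (map_zero _) hd
  smul_mem' c f hf d hd := hf d fun h => hd (by rw [Submodule.coe_smul, map_smul, h, smul_zero])

/-! ### The monomial basis -/

theorem mon_apply (I : VecComp l) (j : Fin I.length → ℕ) (hj : Function.Injective j)
    (r : Fin I.length) (c : Fin l) : mon I j (j r, c) = (I.get r).1 c := by
  classical
  simp only [mon, Finsupp.finsetSum_apply, Finsupp.single_apply, Prod.mk.injEq]
  rw [Finset.sum_eq_single r, Finset.sum_eq_single c]
  · simp
  · intro b _ hb
    simp [hb]
  · simp
  · intro b _ hb
    simp [hj.ne hb]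
  · simp

theorem mon_apply_eq_zero (I : VecComp l) (j : Fin I.length → ℕ)
    (a : ℕ) (ha : a ∉ Set.range j) (c : Fin l) : mon I j (a, c) = 0 := by
  classical
  simp only [mon, Finsupp.finsetSum_apply, Finsupp.single_apply, Prod.mk.injEq]
  refine Finset.sum_eq_zero fun r _ => Finset.sum_eq_zero fun b _ => ?_
  rw [if_neg]
  rintro ⟨h, -⟩
  exact ha ⟨r, h⟩

theorem mem_range_iff (I : VecComp l) (j : Fin I.length → ℕ) (hj : Function.Injective j)
    (a : ℕ) : a ∈ Set.range j ↔ ∃ c, mon I j (a, c) ≠ 0 := by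
  constructor
  · rintro ⟨r, rfl⟩
    have := (I.get r).2
    obtain ⟨c, hc⟩ := Function.ne_iff.1 this
    exact ⟨c, by rw [mon_apply I j hj]; exact hc⟩
  · rintro ⟨c, hc⟩
    by_contra h
    exact hc (mon_apply_eq_zero I j a h c)

theorem mon_inj (I J : VecComp l) (j : Fin I.length → ℕ) (j' : Fin J.length → ℕ)
    (hj : StrictMono j) (hj' : StrictMono j') (h : mon I j = mon J j') : I = J := by
  have hr : Set.range j = Set.range j' := by
    ext a
    rw [mem_range_iff I j hj.injective, mem_range_iff J j' hj'.injective, h]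
  have hlen : I.length = J.length := by
    have h1 := Set.ncard_range_of_injective hj.injective
    have h2 := Set.ncard_range_of_injective hj'.injective
    rw [hr, h2] at h1
    simpa using h1.symm
  have hjj : j = j' ∘ Fin.cast hlen := by
    refine (StrictMono.range_inj hj (hj'.comp (Fin.cast_strictMono hlen))).1 ?_
    rw [hr, Set.range_comp, (finCongr hlen).surjective.range_eq (f := Fin.cast hlen), Set.image_univ]
  refine List.ext_get hlen fun r h1 h2 => Subtype.ext (funext fun c => ?_)
  rw [← mon_apply I j hj.injective ⟨r, h1⟩ c, ← mon_apply J j' hj'.injective ⟨r, h2⟩ c, h, hjj]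
  rfl

theorem exists_mon (d : (ℕ × Fin l) →₀ ℕ) :
    ∃ (I : VecComp l) (j : Fin I.length → ℕ), StrictMono j ∧ d = mon I j := by
  classical
  set s : Finset ℕ := d.support.image Prod.fst with hs
  set e := s.orderEmbOfFin rfl with he
  have hne : ∀ r, (fun c => d (e r, c)) ≠ 0 := by
    intro r h0
    have hmem : e r ∈ s := Finset.orderEmbOfFin_mem s rfl r
    obtain ⟨⟨a, c⟩, hac, ha⟩ := Finset.mem_image.1 hmem
    have : d (e r, c) = 0 := congrFun h0 c
    rw [Finsupp.mem_support_iff] at hac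
    simp only at ha
    rw [ha] at hac
    exact hac this
  let I : VecComp l := List.ofFn fun r => ⟨fun c => d (e r, c), hne r⟩
  have hI : I.length = s.card := List.length_ofFn
  let j : Fin I.length → ℕ := fun r => e (Fin.cast hI r)
  have hj : StrictMono j := e.strictMono.comp (Fin.cast_strictMono hI)
  refine ⟨I, j, hj, ?_⟩
  ext ⟨a, c⟩
  by_cases ha : a ∈ Set.range j
  · obtain ⟨r, rfl⟩ := ha
    rw [mon_apply I j hj.injective]
    simp only [I, j, List.get_ofFn]
  · rw [mon_apply_eq_zero I j a ha]
    by_contra hd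
    apply ha
    have : a ∈ s := Finset.mem_image.2 ⟨(a, c), Finsupp.mem_support_iff.2 hd, rfl⟩
    rw [← Finset.mem_coe, ← Finset.range_orderEmbOfFin s rfl] at this
    obtain ⟨r, hr⟩ := this
    exact ⟨Fin.cast hI.symm r, hr⟩

theorem mdeg_add (d e : (ℕ × Fin l) →₀ ℕ) : mdeg (d + e) = mdeg d + mdeg e :=
  Finsupp.sum_add_index' (fun _ => by simp) fun _ _ _ => Pi.single_add _ _ _

/-- `mdeg` as an additive map. -/
def mdegHom : ((ℕ × Fin l) →₀ ℕ) →+ (Fin l → ℕ) where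
  toFun := mdeg
  map_zero' := Finsupp.sum_zero_index
  map_add' := mdeg_add

theorem mdeg_mon (I : VecComp l) (j : Fin I.length → ℕ) : mdeg (mon I j) = colSum I := by
  change mdegHom (mon I j) = _
  rw [mon, map_sum, colSum]
  have : ∀ r, mdegHom (∑ c, Finsupp.single (j r, c) ((I.get r).1 c)) = (I.get r).1 := by
    intro r
    rw [map_sum]
    have : ∀ c, mdegHom (Finsupp.single (j r, c) ((I.get r).1 c)) =
        Pi.single c ((I.get r).1 c) := fun c => Finsupp.sum_single_index (by simp)
    rw [Finset.sum_congr rfl fun c _ => this c, Finset.univ_sum_single]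
  rw [Finset.sum_congr rfl fun r _ => this r]
  conv_rhs => rw [← List.ofFn_get I, List.map_ofFn, List.sum_ofFn]
  rfl

theorem degree_eq (d : (ℕ × Fin l) →₀ ℕ) : d.degree = weight (mdeg d) := by
  induction d using Finsupp.induction_linear with
  | zero => simp [weight, mdeg]
  | add d e hd he =>
    rw [map_add, hd, he, mdeg_add]
    simp [weight, Finset.sum_add_distrib]
  | single a e =>
    rw [mdeg, Finsupp.sum_single_index (by simp), weight]
    simp

theorem length_le_weight (I : VecComp l) : I.length ≤ weight (colSum I) := by
  induction I with
  | nil => simp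
  | cons a I ih =>
    have h1 : weight (colSum (a :: I)) = weight a.1 + weight (colSum I) := by
      simp [weight, colSum, Finset.sum_add_distrib]
    have h2 : weight a.1 ≠ 0 := by
      intro h
      apply a.2
      funext i
      exact Finset.sum_eq_zero_iff.1 h i (Finset.mem_univ i)
    rw [h1, List.length_cons]
    omega

theorem finite_weight_le (N : ℕ) : {I : VecComp l | weight (colSum I) ≤ N}.Finite := by
  classical
  let B : (ℕ × Fin l) →₀ ℕ :=
    Finsupp.onFinset (Finset.range N ×ˢ Finset.univ) (fun a => if a.1 < N then N else 0)
      fun a ha => by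
        simp only [ne_eq, ite_eq_right_iff, not_forall] at ha
        simp [ha.1]
  refine Set.Finite.of_injOn (f := fun I => mon I fun r => r.val) (t := Set.Iic B) ?_ ?_
    (Set.finite_Iic B)
  · intro I hI
    rw [Set.mem_ofPred_eq] at hI
    rintro ⟨a, c⟩
    simp only [B, Finsupp.onFinset_apply]
    split_ifs with ha
    · have h1 := degree_eq (mon I fun r => r.val)
      rw [mdeg_mon] at h1
      exact (Finsupp.le_degree (a, c) _).trans (h1.le.trans hI)
    · rw [mon_apply_eq_zero]
      rintro ⟨r, hr⟩
      simp only at hr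
      have := length_le_weight I
      have := r.2
      omega
  · intro I _ J _ h
    exact mon_inj I J _ _ Fin.val_strictMono Fin.val_strictMono h

open Classical in
/-- The monomial quasisymmetric function `M_I = ∑_{j_1 < ⋯ < j_m} x_{j_1}^{i_1} ⋯ x_{j_m}^{i_m}`
as a power series. (The monomials in this sum are pairwise distinct.) -/
def monomialSeries (I : VecComp l) : MvPowerSeries (ℕ × Fin l) ℚ :=
  fun d => if ∃ j : Fin I.length → ℕ, StrictMono j ∧ d = mon I j then 1 else 0

theorem coeff_monomialSeries (I J : VecComp l) (j : Fin J.length → ℕ) (hj : StrictMono j) :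
    MvPowerSeries.coeff (mon J j) (monomialSeries I) = if J = I then 1 else 0 := by
  classical
  rw [MvPowerSeries.coeff_apply, monomialSeries]
  refine if_congr ⟨?_, ?_⟩ rfl rfl
  · rintro ⟨j', hj', h⟩
    exact mon_inj J I j j' hj hj' h
  · rintro rfl
    exact ⟨j, hj, rfl⟩

/-- The monomial quasisymmetric function `M_I`. -/
def M (I : VecComp l) : QSym l :=
  ⟨monomialSeries I, ⟨weight (colSum I), fun d hd => by
    obtain ⟨J, j, hj, rfl⟩ := exists_mon d
    rw [coeff_monomialSeries I J j hj] at hd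
    have : J = I := by
      by_contra h
      simp [h] at hd
    rw [degree_eq, mdeg_mon, this]⟩, fun J j hj => by
    rw [coeff_monomialSeries I J j hj, coeff_monomialSeries I J _ Fin.val_strictMono]⟩

theorem M_mem_component (I : VecComp l) : M I ∈ component l (colSum I) := by
  intro d hd
  obtain ⟨J, j, hj, rfl⟩ := exists_mon d
  have : J = I := by
    by_contra h
    exact hd ((coeff_monomialSeries I J j hj).trans (if_neg h))
  rw [mdeg_mon, this]

theorem QSym_ext {f g : QSym l}
    (h : ∀ I, MvPowerSeries.coeff (mon I fun r => r.val) f.1 =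
      MvPowerSeries.coeff (mon I fun r => r.val) g.1) : f = g := by
  refine Subtype.ext (MvPowerSeries.ext fun d => ?_)
  obtain ⟨I, j, hj, rfl⟩ := exists_mon d
  rw [f.2.2 I j hj, g.2.2 I j hj, h]

theorem finite_coeff (f : QSym l) :
    {I : VecComp l | MvPowerSeries.coeff (mon I fun r => r.val) f.1 ≠ 0}.Finite := by
  obtain ⟨N, hN⟩ := f.2.1
  refine (finite_weight_le N).subset fun I hI => ?_
  have := hN _ hI
  rwa [degree_eq, mdeg_mon] at this

/-- The coordinates of a quasisymmetric function with respect to the monomial functions. -/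
def reprHom : QSym l →ₗ[ℚ] (VecComp l →₀ ℚ) where
  toFun f := Finsupp.ofSupportFinite
    (fun I => MvPowerSeries.coeff (mon I fun r => r.val) f.1) (finite_coeff f)
  map_add' f g := by
    ext I
    exact map_add (MvPowerSeries.coeff (mon I fun r => r.val)) f.1 g.1
  map_smul' c f := by
    ext I
    exact map_smul (MvPowerSeries.coeff (mon I fun r => r.val)) c f.1

theorem reprHom_apply (f : QSym l) (I : VecComp l) :
    reprHom f I = MvPowerSeries.coeff (mon I fun r => r.val) f.1 := rfl

theorem reprHom_M (I : VecComp l) : reprHom (M I) = Finsupp.single I 1 := by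
  classical
  ext J
  rw [reprHom_apply, Finsupp.single_apply]
  refine (coeff_monomialSeries I J _ Fin.val_strictMono).trans ?_
  simp only [eq_comm]

theorem reprHom_injective : Function.Injective (reprHom (l := l)) := fun _ _ h =>
  QSym_ext fun I => DFunLike.congr_fun h I

variable (l) in
/-- The monomial basis `(M_I)` of `QSym`. -/
def monomialBasis : Module.Basis (VecComp l) ℚ (QSym l) :=
  Module.Basis.ofRepr (LinearEquiv.ofLinearMap reprHom (Finsupp.linearCombination ℚ M)
    (by
      ext I : 1
      refine LinearMap.ext fun c => ?_
      simp [reprHom_M])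
    (by
      refine LinearMap.ext fun f => reprHom_injective ?_
      have : reprHom ∘ₗ Finsupp.linearCombination ℚ (M (l := l)) = LinearMap.id := by
        ext I : 1
        refine LinearMap.ext fun c => ?_
        simp [reprHom_M]
      exact LinearMap.congr_fun this (reprHom f)))

@[simp]
theorem monomialBasis_apply (I : VecComp l) : monomialBasis l I = M I := by
  simp [monomialBasis]

/-! ### The grading -/

theorem repr_eq (f : QSym l) (I : VecComp l) :
    (monomialBasis l).repr f I = MvPowerSeries.coeff (mon I fun r => r.val) f.1 := rfl

theorem repr_M (I : VecComp l) : (monomialBasis l).repr (M I) = Finsupp.single I 1 := reprHom_M I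

theorem repr_eq_zero {n : Fin l → ℕ} {f : QSym l} (hf : f ∈ component l n) {I : VecComp l}
    (hI : colSum I ≠ n) : (monomialBasis l).repr f I = 0 := by
  by_contra h
  exact hI ((mdeg_mon I _).symm.trans (hf _ h))

theorem component_eq_span (n : Fin l → ℕ) :
    component l n = Submodule.span ℚ (M '' {I | colSum I = n}) := by
  refine le_antisymm (fun f hf => ?_) (Submodule.span_le.2 ?_)
  · rw [← (monomialBasis l).linearCombination_repr f, Finsupp.linearCombination_apply]
    refine Submodule.sum_mem _ fun I hI => Submodule.smul_mem _ _ (Submodule.subset_span ?_)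
    refine ⟨I, ?_, (monomialBasis_apply I).symm⟩
    by_contra h
    exact Finsupp.mem_support_iff.1 hI (repr_eq_zero hf h)
  · rintro _ ⟨I, rfl, rfl⟩
    exact M_mem_component I

variable (l) in
/-- Auxiliary map for the decomposition of `QSym` into its homogeneous components. -/
def decomposeHom : QSym l →ₗ[ℚ] DirectSum (Fin l → ℕ) fun n => component l n :=
  (monomialBasis l).constr ℚ fun I =>
    DirectSum.lof ℚ (Fin l → ℕ) (fun n => component l n) (colSum I) ⟨M I, M_mem_component I⟩

theorem decomposeHom_M (I : VecComp l) : decomposeHom l (M I) =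
    DirectSum.lof ℚ (Fin l → ℕ) (fun n => component l n) (colSum I) ⟨M I, M_mem_component I⟩ := by
  have h := (monomialBasis l).constr_basis ℚ (fun I =>
    DirectSum.lof ℚ (Fin l → ℕ) (fun n => component l n) (colSum I) ⟨M I, M_mem_component I⟩) I
  rwa [monomialBasis_apply] at h

/-- `QSym` is the direct sum of its homogeneous components. -/
instance : DirectSum.Decomposition (component l) :=
  DirectSum.Decomposition.ofLinearMap (component l) (decomposeHom l)
    (by
      refine (monomialBasis l).ext fun I => ?_
      rw [monomialBasis_apply, LinearMap.comp_apply, decomposeHom_M]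
      simp)
    (by
      refine DirectSum.linearMap_ext ℚ fun n => LinearMap.ext fun f => ?_
      obtain ⟨f, hf⟩ := f
      simp only [LinearMap.comp_apply, DirectSum.coeLinearMap_lof, LinearMap.id_apply]
      have key : ∀ g ∈ Submodule.span ℚ (M '' {I : VecComp l | colSum I = n}),
          ∀ hg : g ∈ component l n, decomposeHom l g =
            DirectSum.lof ℚ (Fin l → ℕ) (fun n => component l n) n ⟨g, hg⟩ := by
        intro g hg
        induction hg using Submodule.span_induction with
        | mem g hg =>
          obtain ⟨I, rfl, rfl⟩ := hg
          intro hg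
          exact decomposeHom_M I
        | zero =>
          intro hg
          rw [map_zero]
          exact (map_zero _).symm
        | add x y hx hy ihx ihy =>
          intro hg
          rw [← component_eq_span] at hx hy
          rw [map_add, ihx hx, ihy hy, ← map_add]
          rfl
        | smul c x hx ihx =>
          intro hg
          rw [← component_eq_span] at hx
          rw [map_smul, ihx hx, ← map_smul]
          rfl
      exact key f (component_eq_span n ▸ hf) hf)

/-! ### The coalgebra structure -/

variable (l) in
/-- The coproduct `Δ(M_I) = ∑_{I = J K} M_J ⊗ M_K`. -/
def comulHom : QSym l →ₗ[ℚ] QSym l ⊗[ℚ] QSym l :=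
  (monomialBasis l).constr ℚ fun I =>
    ∑ i ∈ Finset.range (I.length + 1), M (I.take i) ⊗ₜ[ℚ] M (I.drop i)

variable (l) in
/-- The counit: the projection to the component of degree zero. -/
def counitHom : QSym l →ₗ[ℚ] ℚ :=
  (monomialBasis l).constr ℚ fun I => if I = [] then 1 else 0

theorem comulHom_M (I : VecComp l) : comulHom l (M I) =
    ∑ i ∈ Finset.range (I.length + 1), M (I.take i) ⊗ₜ[ℚ] M (I.drop i) := by
  conv_lhs => rw [← monomialBasis_apply, comulHom, Module.Basis.constr_basis]

theorem counitHom_M (I : VecComp l) : counitHom l (M I) = if I = [] then 1 else 0 := by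
  conv_lhs => rw [← monomialBasis_apply, counitHom, Module.Basis.constr_basis]

instance : Coalgebra ℚ (QSym l) where
  comul := comulHom l
  counit := counitHom l
  coassoc := by
    refine (monomialBasis l).ext fun I => ?_
    simp only [monomialBasis_apply, LinearMap.comp_apply, comulHom_M, map_sum,
      LinearMap.rTensor_tmul, LinearMap.lTensor_tmul, TensorProduct.sum_tmul,
      TensorProduct.tmul_sum, LinearEquiv.coe_coe, TensorProduct.assoc_tmul]
    rw [Finset.sum_sigma', Finset.sum_sigma']
    refine Finset.sum_nbij' (fun p => ⟨p.2, p.1 - p.2⟩) (fun p => ⟨p.1 + p.2, p.1⟩) ?_ ?_ ?_ ?_ ?_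
    · rintro ⟨i, j⟩ h
      simp only [Finset.mem_sigma, Finset.mem_range, List.length_take, List.length_drop] at h ⊢
      omega
    · rintro ⟨i, j⟩ h
      simp only [Finset.mem_sigma, Finset.mem_range, List.length_take, List.length_drop] at h ⊢
      omega
    · rintro ⟨i, j⟩ h
      simp only [Finset.mem_sigma, Finset.mem_range, List.length_take] at h
      have : j + (i - j) = i := by omega
      simp [this]
    · rintro ⟨i, j⟩ h
      simp
    · rintro ⟨i, j⟩ h
      simp only [Finset.mem_sigma, Finset.mem_range, List.length_take] at h
      have h1 : min j i = j := by omega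
      have h2 : j + (i - j) = i := by omega
      simp only [List.take_take, List.drop_take, List.drop_drop, h1, h2]
  rTensor_counit_comp_comul := by
    refine (monomialBasis l).ext fun I => ?_
    simp only [monomialBasis_apply, LinearMap.comp_apply, comulHom_M, map_sum,
      LinearMap.rTensor_tmul, counitHom_M]
    rw [Finset.sum_eq_single 0]
    · simp
    · intro i hi h0
      rw [if_neg, TensorProduct.zero_tmul]
      rw [← List.length_eq_zero_iff, List.length_take]
      rw [Finset.mem_range] at hi
      omega
    · simp
  lTensor_counit_comp_comul := by
    refine (monomialBasis l).ext fun I => ?_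
    simp only [monomialBasis_apply, LinearMap.comp_apply, comulHom_M, map_sum,
      LinearMap.lTensor_tmul, counitHom_M]
    rw [Finset.sum_eq_single I.length]
    · simp
    · intro i hi h0
      rw [if_neg, TensorProduct.tmul_zero]
      rw [← List.length_eq_zero_iff, List.length_drop]
      rw [Finset.mem_range] at hi
      omega
    · simp

theorem comul_M (I : VecComp l) : comul (R := ℚ) (M I) =
    ∑ i ∈ Finset.range (I.length + 1), M (I.take i) ⊗ₜ[ℚ] M (I.drop i) := comulHom_M I

theorem counit_M (I : VecComp l) : counit (R := ℚ) (M I) = if I = [] then 1 else 0 := counitHom_M I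

theorem colSum_append (I J : VecComp l) : colSum (I ++ J) = colSum I + colSum J := by
  simp [colSum]

instance : IsGradedCoalgebra (component l) where
  comul_mem n h hh := by
    rw [component_eq_span] at hh
    refine Submodule.span_le (p := (⨆ (p : (Fin l → ℕ) × (Fin l → ℕ)) (_ : p.1 + p.2 = n),
      LinearMap.range (TensorProduct.map (component l p.1).subtype
        (component l p.2).subtype)).comap (comul (R := ℚ))).2 ?_ hh
    rintro _ ⟨I, rfl, rfl⟩
    rw [SetLike.mem_coe, Submodule.mem_comap, comul_M]
    refine Submodule.sum_mem _ fun i _ => ?_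
    refine Submodule.mem_iSup_of_mem (colSum (I.take i), colSum (I.drop i)) ?_
    refine Submodule.mem_iSup_of_mem (by rw [← colSum_append, List.take_append_drop]) ?_
    exact ⟨⟨_, M_mem_component _⟩ ⊗ₜ ⟨_, M_mem_component _⟩, rfl⟩
  counit_eq_zero n hn h hh := by
    rw [component_eq_span] at hh
    refine Submodule.span_le (p := LinearMap.ker (counit (R := ℚ))).2 ?_ hh
    rintro _ ⟨I, rfl, rfl⟩
    rw [SetLike.mem_coe, LinearMap.mem_ker, counit_M, if_neg]
    rintro rfl
    exact hn rfl

theorem conv_M (f g : WithConv (QSym l →ₗ[ℚ] ℚ)) (I : VecComp l) :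
    (f * g) (M I) = ∑ i ∈ Finset.range (I.length + 1), f (M (I.take i)) * g (M (I.drop i)) := by
  rw [LinearMap.convMul_apply, comul_M, map_sum, map_sum]
  rfl

/-! ### The universal character -/

variable (l) in
/-- The universal character `ζ_Q`: `ζ_Q(M_I) = 1` if `I` has at most one column, and
`ζ_Q(M_I) = 0` otherwise. -/
def zeta : WithConv (QSym l →ₗ[ℚ] ℚ) :=
  toConv ((monomialBasis l).constr ℚ fun I => if I.length ≤ 1 then 1 else 0)

variable (l) in
/-- The convolution inverse of `ζ_Q`; see `zetaUnit`. -/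
def zetaInv : WithConv (QSym l →ₗ[ℚ] ℚ) :=
  toConv ((monomialBasis l).constr ℚ fun I => (-1) ^ I.length)

theorem zeta_M (I : VecComp l) : zeta l (M I) = if I.length ≤ 1 then 1 else 0 := by
  rw [← monomialBasis_apply]
  exact Module.Basis.constr_basis _ _ _ _

theorem zetaInv_M (I : VecComp l) : zetaInv l (M I) = (-1) ^ I.length := by
  rw [← monomialBasis_apply]
  exact Module.Basis.constr_basis _ _ _ _

theorem conv_ext {f g : WithConv (QSym l →ₗ[ℚ] ℚ)} (h : ∀ I, f (M I) = g (M I)) : f = g := by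
  refine WithConv.ext ((monomialBasis l).ext fun I => ?_)
  rw [monomialBasis_apply]
  exact h I

theorem zeta_mul_zetaInv : zeta l * zetaInv l = 1 := by
  refine conv_ext fun I => ?_
  rw [conv_M, LinearMap.convOne_apply, counit_M]
  rcases I with _ | ⟨a, I⟩
  · simp [zeta_M, zetaInv_M]
  · rw [List.length_cons, Finset.sum_range_succ', Finset.sum_range_succ']
    rw [Finset.sum_eq_zero]
    · simp [zeta_M, zetaInv_M, pow_succ]
    · intro i hi
      rw [Finset.mem_range] at hi
      rw [zeta_M, if_neg, zero_mul]
      rw [List.length_take, List.length_cons]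
      omega

theorem zetaInv_mul_zeta : zetaInv l * zeta l = 1 := by
  refine conv_ext fun I => ?_
  rw [conv_M, LinearMap.convOne_apply, counit_M]
  rcases I with _ | ⟨a, I⟩
  · simp [zeta_M, zetaInv_M]
  · rw [List.length_cons, Finset.sum_range_succ, Finset.sum_range_succ]
    rw [Finset.sum_eq_zero]
    · simp [zeta_M, zetaInv_M, pow_succ]
    · intro i hi
      rw [Finset.mem_range] at hi
      rw [zeta_M, if_neg, mul_zero]
      rw [List.length_drop, List.length_cons]
      omega

variable (l) in
/-- `ζ_Q` as a unit of the convolution algebra. -/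
def zetaUnit : (WithConv (QSym l →ₗ[ℚ] ℚ))ˣ :=
  ⟨zeta l, zetaInv l, zeta_mul_zetaInv, zetaInv_mul_zeta⟩

/-! ### The basis `η` and its dual basis `Υ` -/

theorem Refines.colSum_eq {I J : VecComp l} (h : Refines I J) : colSum J = colSum I := by
  obtain ⟨L, rfl, hL⟩ := h
  rw [colSum, colSum, ← hL, List.map_flatten, List.sum_flatten, List.map_map]
  rfl

theorem Refines.length_le_and {I J : VecComp l} (h : Refines I J) :
    I.length ≤ J.length ∧ (I.length = J.length → I = J) := by
  obtain ⟨L, rfl, hL⟩ := h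
  induction L generalizing I with
  | nil =>
    have : I = [] := List.map_eq_nil_iff.1 hL.symm
    simp [this]
  | cons K L ih =>
    rcases I with _ | ⟨a, I⟩
    · simp at hL
    · simp only [List.map_cons, List.cons.injEq] at hL
      obtain ⟨h1, h2⟩ := ih hL.2
      rw [List.flatten_cons, List.length_append, List.length_cons]
      rcases K with _ | ⟨b, K⟩
      · exact absurd hL.1.symm a.2
      · refine ⟨by simp only [List.length_cons]; omega, fun h => ?_⟩
        simp only [List.length_cons] at h
        have hK : K = [] := List.length_eq_zero_iff.1 (by omega)
        subst hK
        have h3 := h2 (by simp only [List.length_nil] at h; omega)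
        have h4 : b = a := Subtype.ext (by simpa [colSum] using hL.1)
        rw [h4, ← h3]
        rfl

theorem Refines.refl (I : VecComp l) : Refines I I := by
  refine ⟨I.map fun a => [a], ?_, ?_⟩
  · induction I with
    | nil => rfl
    | cons a I ih => rw [List.map_cons, List.flatten_cons, ih, List.singleton_append]
  · rw [List.map_map]
    refine List.map_congr_left fun a _ => ?_
    simp [colSum]

theorem finite_coarsenings (I : VecComp l) : {J : VecComp l | Refines J I}.Finite :=
  (finite_weight_le (weight (colSum I))).subset fun _ hJ => by
    rw [Set.mem_ofPred_eq, ← Refines.colSum_eq hJ]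

/-- The vector compositions `J` with `J ⊴ I`. -/
def coarsenings (I : VecComp l) : Finset (VecComp l) := (finite_coarsenings I).toFinset

theorem mem_coarsenings {I J : VecComp l} : J ∈ coarsenings I ↔ Refines J I := by
  simp [coarsenings]

/-- `η_I = ∑_{J ⊴ I} 2^{ℓ(J)} M_J`. -/
def eta (I : VecComp l) : QSym l := ∑ J ∈ coarsenings I, (2 : ℚ) ^ J.length • M J

open Classical in
theorem eta_eq (I : VecComp l) : eta I = (2 : ℚ) ^ I.length • M I +
    ∑ J ∈ (coarsenings I).erase I, (2 : ℚ) ^ J.length • M J :=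
  (Finset.add_sum_erase _ _ (mem_coarsenings.2 (Refines.refl I))).symm

theorem length_lt_of_mem_erase [DecidableEq (VecComp l)] {I J : VecComp l}
    (h : J ∈ (coarsenings I).erase I) : J.length < I.length := by
  rw [Finset.mem_erase, mem_coarsenings] at h
  have h1 := h.2.length_le_and
  exact lt_of_le_of_ne h1.1 fun h2 => h.1 (h1.2 h2)

open Classical in
/-- The preimage of `M_I` under the linear map `M_J ↦ η_J`. -/
def etaInv (I : VecComp l) : QSym l :=
  ((2 : ℚ) ^ I.length)⁻¹ • (M I - ∑ J : {J // J ∈ (coarsenings I).erase I},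
    (2 : ℚ) ^ J.1.length • etaInv J.1)
termination_by I.length
decreasing_by exact length_lt_of_mem_erase J.2

open Classical in
theorem etaInv_eq (I : VecComp l) : (2 : ℚ) ^ I.length • etaInv I = M I -
    ∑ J ∈ (coarsenings I).erase I, (2 : ℚ) ^ J.length • etaInv J := by
  rw [etaInv, smul_smul, mul_inv_cancel₀ (by positivity), one_smul]
  congr 1
  exact Finset.sum_coe_sort ((coarsenings I).erase I) fun J => (2 : ℚ) ^ J.length • etaInv J

theorem etaInv_mem (I : VecComp l) : etaInv I ∈ component l (colSum I) := by
  classical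
  induction hn : I.length using Nat.strong_induction_on generalizing I with
  | _ n ih =>
    have h : (2 : ℚ) ^ I.length • etaInv I ∈ component l (colSum I) := by
      rw [etaInv_eq]
      refine Submodule.sub_mem _ (M_mem_component I) (Submodule.sum_mem _ fun J hJ => ?_)
      refine Submodule.smul_mem _ _ ?_
      have h1 := (mem_coarsenings.1 (Finset.mem_of_mem_erase hJ)).colSum_eq
      rw [h1]
      exact ih _ (hn ▸ length_lt_of_mem_erase hJ) J rfl
    exact ((component l (colSum I)).smul_mem_iff (by positivity)).1 h

variable (l) in
/-- The linear automorphism `M_I ↦ η_I` of `QSym`. -/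
def etaEquiv : QSym l ≃ₗ[ℚ] QSym l :=
  LinearEquiv.ofLinearMap ((monomialBasis l).constr ℚ eta) ((monomialBasis l).constr ℚ etaInv)
    (by
      classical
      have hb : ∀ I, (monomialBasis l).constr ℚ eta (M I) = eta I := fun I => by
        rw [← monomialBasis_apply, Module.Basis.constr_basis]
      have key : ∀ I, (monomialBasis l).constr ℚ eta (etaInv I) = M I := by
        intro I
        induction hn : I.length using Nat.strong_induction_on generalizing I with
        | _ n ih =>
          have h : (2 : ℚ) ^ I.length • (monomialBasis l).constr ℚ eta (etaInv I) =
              (2 : ℚ) ^ I.length • M I := by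
            rw [← map_smul, etaInv_eq, map_sub, map_sum, hb, eta_eq, add_sub_assoc, ← sub_eq_zero,
              add_sub_cancel_left, sub_eq_zero]
            refine Finset.sum_congr rfl fun J hJ => ?_
            rw [map_smul, ih _ (hn ▸ length_lt_of_mem_erase hJ) J rfl]
          exact smul_right_injective (QSym l) (r := (2 : ℚ) ^ I.length) (by positivity) h
      refine (monomialBasis l).ext fun I => ?_
      rw [LinearMap.comp_apply, Module.Basis.constr_basis, key]
      simp)
    (by
      classical
      have hb : ∀ I, (monomialBasis l).constr ℚ etaInv (M I) = etaInv I := fun I => by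
        rw [← monomialBasis_apply, Module.Basis.constr_basis]
      refine (monomialBasis l).ext fun I => ?_
      rw [LinearMap.comp_apply, Module.Basis.constr_basis, eta_eq, map_add, map_smul, hb,
        etaInv_eq, map_sum]
      simp [hb])

variable (l) in
/-- The basis `(η_I)` of `QSym`. -/
def etaBasis : Module.Basis (VecComp l) ℚ (QSym l) := (monomialBasis l).map (etaEquiv l)

@[simp]
theorem etaBasis_apply (I : VecComp l) : etaBasis l I = eta I := by
  rw [etaBasis, Module.Basis.map_apply]
  exact Module.Basis.constr_basis _ _ _ _

/-- The element `Υ^I` of the graded dual of `QSym`: the `I`-th coordinate functional of the basis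
`(η_J)`, so `Υ^I(η_J) = δ_{I,J}`. -/
def upsilon (I : VecComp l) : gradedDual (component l) :=
  ⟨toConv ((etaBasis l).coord I), by
    refine (Set.finite_singleton (colSum I)).subset ?_
    rintro n ⟨h, hh, hne⟩
    by_contra hn
    apply hne
    rw [component_eq_span] at hh
    refine Submodule.span_le (p := LinearMap.ker ((etaBasis l).coord I)).2 ?_ hh
    rintro _ ⟨J, rfl, rfl⟩
    rw [SetLike.mem_coe, LinearMap.mem_ker, Module.Basis.coord_apply]
    have : (etaBasis l).repr (M J) = (monomialBasis l).repr (etaInv J) := by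
      rw [etaBasis, Module.Basis.map_repr, LinearEquiv.trans_apply]
      congr 1
      rw [← monomialBasis_apply]
      exact (monomialBasis l).constr_basis ℚ etaInv J
    rw [this]
    exact repr_eq_zero (etaInv_mem J) (fun h => hn h.symm)⟩

open Classical in
theorem upsilon_eta (I J : VecComp l) :
    (upsilon I).1 (eta J) = if J = I then 1 else 0 := by
  change (etaBasis l).coord I (eta J) = _
  rw [← etaBasis_apply, Module.Basis.coord_apply, Module.Basis.repr_self, Finsupp.single_apply]

end LevelQSym

end

noncomputable section

namespace LevelQSym

open Coalgebra TensorProduct WithConv Multigraded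

variable {l : ℕ}

/-! In the basis `eta` all the data become simple. The coproduct is still deconcatenation, because
cutting a coarsening is the same as coarsening the two parts of a cut and the factor `2 ^ ℓ` is
multiplicative (`comul_eta`). Dually, the `upsilon` multiply by concatenation (`upsilon_mul`), so
`Υ^I` is the product of the `Υ` of its columns. For `I ≠ []` one has `ζ(η_I) = 2` and `ζ⁻¹(η_I) = 2
(-1)^ℓ(I)`.

Hence the degree `n` generator of the odd ideal is the sum of `2 ((-1)^|n| - (-1)^ℓ(I)) Υ^I` over
the compositions `I` of `n ≠ 0`; for `n = 0` it vanishes. If all columns of `I` are odd, then `|n|`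
and `ℓ(I)` have the same parity and the term drops out. Every other `I` has an even column, which is
at most `n`, so its term lies in the ideal generated by the even `Υ_i` with `i ≤ k`. Conversely, for
`|n|` even the term of `I = (n)` is `4 Υ_n`, and all other terms involve only even columns of
smaller weight. Induction on the weight puts `Υ_n` into the odd ideal (`upsilon_mem_oddIdeal`).

For the subalgebra, the functionals vanishing on a subcoalgebra form a two-sided ideal. If `ζ̄` and
`ζ⁻¹` agree on the `k`-initial part of a graded subcoalgebra, the odd ideal therefore kills it
(`apply_eq_zero_of_mem_oddIdeal`). In particular the coordinate functional `Υ^I` does so whenever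
`I` has an even column `≤ k`, which gives one inclusion. The other holds because the proposed span
is itself an agreeing graded subcoalgebra (`span_eta_mem_agreeing`). -/

/-! ### Weights and column sums -/

theorem weight_add (m n : Fin l → ℕ) : weight (m + n) = weight m + weight n := by
  simp [weight, Finset.sum_add_distrib]

theorem leExt_of_le {m n : Fin l → ℕ} {k : Fin l → ℕ∞} (h : m ≤ n) (hn : LeExt n k) :
    LeExt m k := fun i => (Nat.cast_le.2 (h i)).trans (hn i)

@[simp]
theorem colSum_nil : colSum ([] : VecComp l) = 0 := rfl

@[simp]
theorem colSum_singleton (a : {n : Fin l → ℕ // n ≠ 0}) : colSum [a] = a.1 := by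
  simp [colSum]

theorem colSum_cons (a : {n : Fin l → ℕ // n ≠ 0}) (I : VecComp l) :
    colSum (a :: I) = a.1 + colSum I := by
  simp [colSum]

theorem colSum_ne_zero {I : VecComp l} (h : I ≠ []) : colSum I ≠ 0 := by
  intro h0
  have := length_le_weight I
  rw [h0] at this
  exact h (List.length_eq_zero_iff.1 (by simpa [weight] using this))

theorem le_colSum_of_mem {I : VecComp l} {a : {n : Fin l → ℕ // n ≠ 0}} (h : a ∈ I) :
    a.1 ≤ colSum I := by
  obtain ⟨A, B, rfl⟩ := List.append_of_mem h
  rw [colSum_append, colSum_cons]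
  exact le_add_left (le_add_of_nonneg_right (zero_le))

/-- A column of a vector composition with at least two columns has smaller weight than the sum. -/
theorem weight_lt_of_mem {I : VecComp l} (hI : 1 < I.length) {a : {n : Fin l → ℕ // n ≠ 0}}
    (h : a ∈ I) : weight a.1 < weight (colSum I) := by
  obtain ⟨A, B, rfl⟩ := List.append_of_mem h
  have hA := length_le_weight A
  have hB := length_le_weight B
  rw [colSum_append, colSum_cons, weight_add, weight_add]
  simp only [List.length_append, List.length_cons] at hI
  omega

/-- If all columns are odd, the parity of the total weight is that of the number of columns. -/
theorem neg_one_pow_weight_colSum {I : VecComp l} (h : ∀ i ∈ I, Odd (weight i.1)) :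
    (-1 : ℚ) ^ weight (colSum I) = (-1) ^ I.length := by
  induction I with
  | nil => simp [weight]
  | cons a I ih =>
    rw [colSum_cons, weight_add, pow_add, ih fun i hi => h i (List.mem_cons_of_mem _ hi),
      (h a List.mem_cons_self).neg_one_pow, List.length_cons, pow_succ']

/-! ### Refinements and concatenation -/

theorem Refines.append {I J K L : VecComp l} (h : Refines I K) (h' : Refines J L) :
    Refines (I ++ J) (K ++ L) := by
  obtain ⟨A, rfl, hA⟩ := h
  obtain ⟨B, rfl, hB⟩ := h'
  exact ⟨A ++ B, List.flatten_append, by rw [List.map_append, List.map_append, hA, hB]⟩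

/-- The list of blocks witnessing the refinement splits where `I` ends, and flattening its two
halves cuts `K`. -/
theorem refines_append_left {I J K : VecComp l} (h : Refines (I ++ J) K) :
    ∃ A B, K = A ++ B ∧ Refines I A ∧ Refines J B := by
  obtain ⟨L, rfl, hL⟩ := h
  rw [List.map_append] at hL
  obtain ⟨A, B, rfl, hA, hB⟩ := List.map_eq_append_iff.1 hL
  exact ⟨A.flatten, B.flatten, List.flatten_append, ⟨A, rfl, hA⟩, ⟨B, rfl, hB⟩⟩

/-- Columns are nonzero, so the partial sums of `K` strictly increase and determine the cut. This
gives injectivity in `sum_coarsenings_cuts`. -/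
theorem take_eq_of_colSum_eq {K : VecComp l} {a b : ℕ} (ha : a ≤ K.length) (hb : b ≤ K.length)
    (h : colSum (K.take a) = colSum (K.take b)) : a = b := by
  wlog hab : a ≤ b generalizing a b
  · exact (this hb ha h.symm (le_of_not_ge hab)).symm
  by_contra hne
  have h1 : K.take b = K.take a ++ (K.drop a).take (b - a) := by
    rw [← List.take_add, Nat.add_sub_cancel' hab]
  rw [h1, colSum_append] at h
  refine colSum_ne_zero (I := (K.drop a).take (b - a)) ?_ (left_eq_add.1 h)
  rw [← List.length_pos_iff_ne_nil, List.length_take, List.length_drop]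
  omega

theorem refines_nil_iff {I : VecComp l} : Refines [] I ↔ I = [] := by
  constructor
  · intro h
    by_contra hI
    exact colSum_ne_zero hI h.colSum_eq
  · rintro rfl
    exact Refines.refl _

theorem refines_singleton_iff {a : {n : Fin l → ℕ // n ≠ 0}} {I : VecComp l} :
    Refines [a] I ↔ a.1 = colSum I := by
  constructor
  · intro h
    rw [h.colSum_eq, colSum_singleton]
  · intro h
    exact ⟨[I], by simp, by simp [h]⟩

/-- Cutting a coarsening of `I` amounts to cutting `I` and coarsening both parts. -/
theorem sum_coarsenings_cuts {E : Type*} [AddCommMonoid E] (F : VecComp l → VecComp l → E)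
    (I : VecComp l) :
    ∑ J ∈ coarsenings I, ∑ i ∈ Finset.range (J.length + 1), F (J.take i) (J.drop i) =
      ∑ i ∈ Finset.range (I.length + 1), ∑ A ∈ coarsenings (I.take i),
        ∑ B ∈ coarsenings (I.drop i), F A B := by
  simp_rw [← Finset.sum_product']
  rw [Finset.sum_sigma', Finset.sum_sigma']
  symm
  -- Coarsenings `A` and `B` of the two parts are glued, and `A.length` records where to cut `A ++
  -- B` again. The original position `i` is recovered from `colSum A`, the sum of the first `i`
  -- columns of `I`.
  refine Finset.sum_bij (fun p _ => ⟨p.2.1 ++ p.2.2, p.2.1.length⟩) ?_ ?_ ?_ ?_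
  · rintro ⟨i, A, B⟩ h
    simp only [Finset.mem_sigma, Finset.mem_product, mem_coarsenings, Finset.mem_range,
      List.length_append] at h ⊢
    refine ⟨?_, by omega⟩
    rw [← List.take_append_drop i I]
    exact h.2.1.append h.2.2
  · rintro ⟨i, A, B⟩ h ⟨j, C, D⟩ h' he
    simp only [Finset.mem_sigma, Finset.mem_product, mem_coarsenings, Finset.mem_range,
      Sigma.mk.injEq, heq_eq_eq] at h h' he
    obtain ⟨rfl, rfl⟩ := List.append_inj he.1 he.2
    obtain rfl : i = j := take_eq_of_colSum_eq (K := I) (by omega) (by omega)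
      (h.2.1.colSum_eq.trans h'.2.1.colSum_eq.symm)
    rfl
  · rintro ⟨J, i⟩ h
    simp only [Finset.mem_sigma, mem_coarsenings, Finset.mem_range] at h
    have hJ := h.1
    rw [← List.take_append_drop i J] at hJ
    obtain ⟨A, B, rfl, hA, hB⟩ := refines_append_left hJ
    refine ⟨⟨A.length, J.take i, J.drop i⟩, ?_, ?_⟩
    · simp only [Finset.mem_sigma, Finset.mem_product, mem_coarsenings, Finset.mem_range,
        List.length_append, List.take_left, List.drop_left]
      exact ⟨by omega, hA, hB⟩
    · simp only [List.take_append_drop, List.length_take]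
      rw [min_eq_left (by omega)]
  · rintro ⟨i, A, B⟩ _
    simp

/-! ### The coproduct and the functionals in the basis `η` -/

theorem eta_mem_component (I : VecComp l) : eta I ∈ component l (colSum I) := by
  refine Submodule.sum_mem _ fun J hJ => Submodule.smul_mem _ _ ?_
  rw [(mem_coarsenings.1 hJ).colSum_eq]
  exact M_mem_component J

theorem comul_eta (I : VecComp l) : comul (R := ℚ) (eta I) =
    ∑ i ∈ Finset.range (I.length + 1), eta (I.take i) ⊗ₜ[ℚ] eta (I.drop i) := by
  have h := sum_coarsenings_cuts (fun A B : VecComp l =>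
    ((2 : ℚ) ^ A.length • M A) ⊗ₜ[ℚ] ((2 : ℚ) ^ B.length • M B)) I
  simp only [eta, TensorProduct.sum_tmul, TensorProduct.tmul_sum]
  rw [map_sum]
  refine Eq.trans (Finset.sum_congr rfl fun J _ => ?_)
    (h.trans (Finset.sum_congr rfl fun i _ => Finset.sum_comm))
  rw [map_smul, comul_M, Finset.smul_sum]
  refine Finset.sum_congr rfl fun i _ => ?_
  -- The coefficient `2 ^ ℓ` of a coarsening is the product of the coefficients of its two parts.
  rw [TensorProduct.smul_tmul_smul, ← pow_add, ← List.length_append, List.take_append_drop]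

theorem conv_eta (f g : WithConv (QSym l →ₗ[ℚ] ℚ)) (I : VecComp l) : (f * g) (eta I) =
    ∑ i ∈ Finset.range (I.length + 1), f (eta (I.take i)) * g (eta (I.drop i)) := by
  rw [LinearMap.convMul_apply, comul_eta, map_sum, map_sum]
  rfl

theorem conv_ext_eta {f g : WithConv (QSym l →ₗ[ℚ] ℚ)} (h : ∀ I, f (eta I) = g (eta I)) :
    f = g := by
  refine WithConv.ext ((etaBasis l).ext fun I => ?_)
  rw [etaBasis_apply]
  exact h I

theorem eta_nil : eta ([] : VecComp l) = M [] := by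
  have : coarsenings ([] : VecComp l) = {[]} := by
    ext J
    rw [mem_coarsenings, Finset.mem_singleton]
    refine ⟨fun h => List.length_eq_zero_iff.1 (Nat.le_zero.1 h.length_le_and.1), ?_⟩
    rintro rfl
    exact Refines.refl _
  simp [eta, this]

/-- Of the coarsenings of a nonempty `I`, only the total sum as a single column survives `ζ`, with
coefficient `2 ^ 1`. For `I = []` the value is `1`, whence the hypothesis. -/
theorem zeta_eta {I : VecComp l} (hI : I ≠ []) : zeta l (eta I) = 2 := by
  rw [eta, map_sum, Finset.sum_eq_single [⟨colSum I, colSum_ne_zero hI⟩]]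
  · simp [zeta_M]
  · rintro J hJ hne
    rw [mem_coarsenings] at hJ
    rw [map_smul, zeta_M, if_neg, smul_zero]
    intro hlen
    rcases J with _ | ⟨a, _ | ⟨b, J⟩⟩
    · exact hI (refines_nil_iff.1 hJ)
    · exact hne (congrArg (fun x => [x]) (Subtype.ext (refines_singleton_iff.1 hJ)))
    · simp at hlen
  · intro h
    exact absurd (mem_coarsenings.2 (refines_singleton_iff.2 rfl)) h

theorem counit_eta {I : VecComp l} (hI : I ≠ []) : counit (R := ℚ) (eta I) = 0 :=
  IsGradedCoalgebra.counit_eq_zero _ (colSum_ne_zero hI) _ (eta_mem_component I)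

/-- The contribution of the interior cuts in `zetaInv_eta`, up to a factor `2`. -/
theorem sum_neg_one_pow_succ (m : ℕ) :
    2 * ∑ i ∈ Finset.range m, (-1 : ℚ) ^ (i + 1) = (-1) ^ m - 1 := by
  induction m with
  | zero => simp
  | succ m ih =>
    rw [Finset.sum_range_succ, mul_add, ih]
    ring

/-- The functional `g` with the claimed values is shown to be a left inverse of `ζ`; it then equals
`zetaInv` by uniqueness of inverses. This avoids summing `(-1) ^ ℓ(J) 2 ^ ℓ(J)` over all
coarsenings. -/
theorem zetaInv_eta {I : VecComp l} (hI : I ≠ []) :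
    zetaInv l (eta I) = 2 * (-1) ^ I.length := by
  classical
  set g : WithConv (QSym l →ₗ[ℚ] ℚ) := toConv ((etaBasis l).constr ℚ fun I =>
    if I = [] then 1 else 2 * (-1) ^ I.length) with hg
  have hgeta : ∀ I, g (eta I) = if I = [] then 1 else 2 * (-1) ^ I.length := fun I => by
    rw [← etaBasis_apply]
    exact Module.Basis.constr_basis _ _ _ _
  have hgnil : g (M []) = 1 := by rw [← eta_nil, hgeta, if_pos rfl]
  have key : g * zeta l = 1 := by
    refine conv_ext_eta fun I => ?_
    rw [conv_eta, LinearMap.convOne_apply]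
    rcases I with _ | ⟨a, I⟩
    · simp [eta_nil, hgnil, counit_M, zeta_M]
    -- The two extreme cuts are split off, since there one factor is `η_∅` with value `1` instead of
    -- `±2`. The cut after `i + 1` columns gives `2 (-1)^(i+1) * 2`. With `m = I.length`, the total
    -- is `2 + 2 (-1)^(m+1) + 2 ((-1)^m - 1) = 0`.
    · rw [counit_eta (by simp), map_zero, Finset.sum_range_succ, List.length_cons,
        Finset.sum_range_succ',
        Finset.sum_congr rfl (g := fun i => 4 * (-1 : ℚ) ^ (i + 1))]
      · have h := sum_neg_one_pow_succ I.length
        rw [← Finset.mul_sum]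
        simp only [hgeta, List.take_zero, List.drop_zero, List.take_succ_cons, List.take_length,
          List.drop_succ_cons, List.drop_length, zeta_eta (List.cons_ne_nil a I), eta_nil, zeta_M,
          if_true, if_neg (List.cons_ne_nil a I), List.length_cons, List.length_nil, zero_le,
          pow_succ]
        simp only [pow_succ] at h
        rw [hgnil]
        linear_combination 2 * h
      · intro i hi
        rw [Finset.mem_range] at hi
        have h1 : (a :: I).drop (i + 1) ≠ [] := by
          rw [← List.length_pos_iff_ne_nil, List.length_drop, List.length_cons]
          omega
        rw [hgeta, zeta_eta h1, if_neg (by simp), List.length_take, List.length_cons,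
          min_eq_left (by omega)]
        ring
  have : zetaInv l = g := by
    rw [← one_mul (zetaInv l), ← key, mul_assoc, zeta_mul_zetaInv, mul_one]
  rw [this, hgeta, if_neg hI]

/-! ### The dual basis `Υ` -/

/-- Dual to `comul_eta`: a cut of `K` pairs nontrivially with `Υ^I ⊗ Υ^J` only if its parts are `I`
and `J`, which forces `K = I ++ J` and the cut at `I.length`. -/
theorem upsilon_mul (I J : VecComp l) : upsilon I * upsilon J = upsilon (I ++ J) := by
  classical
  refine Subtype.ext (conv_ext_eta fun K => ?_)
  change ((upsilon I).1 * (upsilon J).1) (eta K) = _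
  rw [conv_eta]
  simp_rw [upsilon_eta]
  split_ifs with h
  · subst h
    rw [Finset.sum_eq_single I.length]
    · simp
    · intro i hi hne
      rw [if_neg, zero_mul]
      intro h
      have := congrArg List.length h
      rw [List.length_take] at this
      rw [Finset.mem_range] at hi
      omega
    · simp
  · refine Finset.sum_eq_zero fun i _ => ?_
    rw [mul_eq_zero]
    by_contra hcon
    simp only [ite_eq_right_iff, one_ne_zero, imp_false, not_or, not_not] at hcon
    exact h (by rw [← hcon.1, ← hcon.2, List.take_append_drop])

theorem upsilon_mem_of_mem {𝓘 : TwoSidedIdeal (gradedDual (component l))} {I : VecComp l}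
    {a : {n : Fin l → ℕ // n ≠ 0}} (ha : a ∈ I) (h : upsilon [a] ∈ 𝓘) : upsilon I ∈ 𝓘 := by
  obtain ⟨A, B, rfl⟩ := List.append_of_mem ha
  rw [← upsilon_mul, ← List.singleton_append, ← upsilon_mul]
  exact 𝓘.mul_mem_left _ _ (𝓘.mul_mem_right _ _ h)

theorem smul_mem_twoSidedIdeal {R A : Type*} [CommRing R] [Ring A] [Algebra R A]
    (𝓘 : TwoSidedIdeal A) (c : R) {x : A} (hx : x ∈ 𝓘) : c • x ∈ 𝓘 := by
  rw [Algebra.smul_def]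
  exact 𝓘.mul_mem_left _ _ hx

theorem mem_of_add_mem_twoSidedIdeal {A : Type*} [Ring A] (𝓘 : TwoSidedIdeal A) {x y : A}
    (h : x + y ∈ 𝓘) (hy : y ∈ 𝓘) : x ∈ 𝓘 := by
  have := 𝓘.sub_mem h hy
  rwa [add_sub_cancel_right] at this

/-! ### Expansion of homogeneous components in the basis `Υ` -/

theorem finite_colSum_eq (n : Fin l → ℕ) : {I : VecComp l | colSum I = n}.Finite :=
  (finite_weight_le (weight n)).subset fun _ hI => (congrArg weight hI).le

/-- The vector compositions of `n`. -/
def compositions (n : Fin l → ℕ) : Finset (VecComp l) := (finite_colSum_eq n).toFinset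

theorem mem_compositions {n : Fin l → ℕ} {I : VecComp l} :
    I ∈ compositions n ↔ colSum I = n := by
  simp [compositions]

theorem component_eq_sum_upsilon (φ : WithConv (QSym l →ₗ[ℚ] ℚ)) (n : Fin l → ℕ) :
    Multigraded.component (component l) φ n =
      ∑ I ∈ compositions n, φ (eta I) • upsilon I := by
  classical
  refine Subtype.ext (conv_ext_eta fun J => ?_)
  have h : ((∑ I ∈ compositions n, φ (eta I) • upsilon I : gradedDual (component l)) :
      WithConv (QSym l →ₗ[ℚ] ℚ)) (eta J) =
      ∑ I ∈ compositions n, φ (eta I) * (upsilon I).1 (eta J) := by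
    rw [AddSubmonoidClass.coe_finsetSum]
    induction compositions n using Finset.induction_on with
    | empty => simp
    | insert a s ha ih =>
      rw [Finset.sum_insert ha, Finset.sum_insert ha, ← ih]
      rfl
  rw [h]
  change φ (proj (component l) n (eta J)) = _
  simp only [upsilon_eta, mul_ite, mul_one, mul_zero, Finset.sum_ite_eq, mem_compositions]
  split_ifs with hJ
  · rw [proj_same _ (hJ ▸ eta_mem_component J)]
  · rw [proj_ne _ (eta_mem_component J) hJ, map_zero]

/-- With odd columns only, the sign `(-1)^|I|` in `ζ̄` equals the sign `(-1)^ℓ(I)` in `ζ⁻¹`. -/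
theorem bar_zeta_eta_eq {I : VecComp l} (h : ∀ i ∈ I, Odd (weight i.1)) :
    bar (component l) (zeta l) (eta I) = zetaInv l (eta I) := by
  rw [bar_apply _ _ (eta_mem_component I), neg_one_pow_weight_colSum h]
  rcases eq_or_ne I [] with rfl | hI
  · simp [eta_nil, zeta_M, zetaInv_M]
  · rw [zeta_eta hI, zetaInv_eta hI, mul_comm]

theorem component_bar_zeta_sub (n : Fin l → ℕ) :
    Multigraded.component (component l) (bar (component l) (zeta l)) n -
        Multigraded.component (component l) (zetaInv l) n =
      ∑ I ∈ compositions n,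
        (bar (component l) (zeta l) (eta I) - zetaInv l (eta I)) • upsilon I := by
  refine Eq.trans (Subtype.ext ?_)
    (component_eq_sum_upsilon (bar (component l) (zeta l) - zetaInv l) n)
  rfl

/-! ### The odd ideal -/

/-- Either all columns are odd and the coefficient vanishes, or a single even column already puts
`Υ^I` into the ideal. Both inclusions for the odd ideal rest on this dichotomy. -/
theorem smul_upsilon_mem {𝓘 : TwoSidedIdeal (gradedDual (component l))} {I : VecComp l}
    (h : ∀ i ∈ I, Even (weight i.1) → upsilon [i] ∈ 𝓘) :
    (bar (component l) (zeta l) (eta I) - zetaInv l (eta I)) • upsilon I ∈ 𝓘 := by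
  by_cases hI : ∀ i ∈ I, Odd (weight i.1)
  · rw [bar_zeta_eta_eq hI, sub_self, zero_smul]
    exact 𝓘.zero_mem
  · push Not at hI
    obtain ⟨i, hi, hodd⟩ := hI
    exact smul_mem_twoSidedIdeal 𝓘 _
      (upsilon_mem_of_mem hi (h i hi (Nat.not_odd_iff_even.1 hodd)))

theorem upsilon_mem_oddIdeal {k : Fin l → ℕ∞} (a : {n : Fin l → ℕ // n ≠ 0}) (hk : LeExt a.1 k)
    (ha : Even (weight a.1)) : upsilon [a] ∈ oddIdeal (component l) k (zetaUnit l) := by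
  classical
  induction hw : weight a.1 using Nat.strong_induction_on generalizing a with
  | _ w ih =>
    set 𝓘 := oddIdeal (component l) k (zetaUnit l) with h𝓘
    have h1 : Multigraded.component (component l) (bar (component l) (zeta l)) a.1 -
        Multigraded.component (component l) (zetaInv l) a.1 ∈ 𝓘 :=
      TwoSidedIdeal.subset_span ⟨a.1, hk, rfl⟩
    have hmem : [a] ∈ compositions a.1 := mem_compositions.2 (colSum_singleton a)
    rw [component_bar_zeta_sub, ← Finset.add_sum_erase _ _ hmem] at h1
    -- Every composition of `a` other than `[a]` has at least two columns. Each of them has smaller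
    -- weight and is `≤ a ≤ k`, so the induction hypothesis covers the even ones.
    have h2 : ∑ I ∈ (compositions a.1).erase [a],
        (bar (component l) (zeta l) (eta I) - zetaInv l (eta I)) • upsilon I ∈ 𝓘 := by
      refine sum_mem fun I hI => smul_upsilon_mem fun i hi heven => ?_
      rw [Finset.mem_erase, mem_compositions] at hI
      have hlen : 1 < I.length := by
        by_contra hlen
        rcases I with _ | ⟨b, _ | ⟨c, I⟩⟩
        · simp at hi
        · exact hI.1 (congrArg (fun x => [x]) (Subtype.ext (by simpa using hI.2)))
        · simp at hlen
      exact ih _ (hw ▸ hI.2 ▸ weight_lt_of_mem hlen hi) i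
        (leExt_of_le (hI.2 ▸ le_colSum_of_mem hi) hk) heven rfl
    have h3 := mem_of_add_mem_twoSidedIdeal 𝓘 h1 h2
    have hne : ([a] : VecComp l) ≠ [] := by simp
    -- As `|a|` is even and `[a]` has one column, the coefficient of `Υ_a` is `2 - (-2) = 4`,
    -- invertible in `ℚ`.
    rw [bar_apply _ _ (eta_mem_component _), colSum_singleton,
      ha.neg_one_pow, zeta_eta hne, zetaInv_eta hne, List.length_singleton] at h3
    have h4 := smul_mem_twoSidedIdeal 𝓘 (1 / 4 : ℚ) h3
    rw [smul_smul] at h4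
    norm_num at h4
    exact h4

theorem oddIdeal_eq_span (k : Fin l → ℕ∞) :
    oddIdeal (component l) k (zetaUnit l) =
      TwoSidedIdeal.span {y | ∃ (n : Fin l → ℕ) (hn : n ≠ 0), LeExt n k ∧
        Even (weight n) ∧ y = upsilon [⟨n, hn⟩]} := by
  refine le_antisymm (TwoSidedIdeal.span_le.2 ?_) (TwoSidedIdeal.span_le.2 ?_)
  · rintro _ ⟨n, hn, rfl⟩
    refine Set.mem_of_eq_of_mem (component_bar_zeta_sub n) ?_
    refine SetLike.mem_coe.2 (sum_mem fun I hI => smul_upsilon_mem fun i hi heven => ?_)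
    have hi' : i.1 ≤ n := mem_compositions.1 hI ▸ le_colSum_of_mem hi
    exact TwoSidedIdeal.subset_span ⟨i.1, i.2, leExt_of_le hi' hn, heven, rfl⟩
  · rintro _ ⟨n, hn, hk, heven, rfl⟩
    exact upsilon_mem_oddIdeal ⟨n, hn⟩ hk heven

/-! ### The odd subalgebra -/

/-- Since `Δ(C) ⊆ C ⊗ C`, one factor vanishing on `C` is enough. So the annihilator of `C` is closed
under multiplication from both sides. -/
theorem convMul_apply_eq_zero {C : Submodule ℚ (QSym l)} (hC : IsGradedSubcoalgebra (component l) C)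
    {f g : WithConv (QSym l →ₗ[ℚ] ℚ)} (h : (∀ x ∈ C, f x = 0) ∨ ∀ x ∈ C, g x = 0)
    {x : QSym l} (hx : x ∈ C) : (f * g) x = 0 := by
  rw [LinearMap.convMul_apply]
  obtain ⟨t, ht⟩ := hC.comul_mem x hx
  rw [← ht]
  clear ht
  induction t with
  | zero => simp
  | add a b ha hb => rw [map_add, map_add, map_add, ha, hb, add_zero]
  | tmul a b =>
    rcases h with h | h
    · have := h a a.2
      simp [this]
    · have := h b b.2
      simp [this]

theorem apply_eq_zero_of_mem_oddIdeal {k : Fin l → ℕ∞} {C : Submodule ℚ (QSym l)}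
    (hC : C ∈ agreeing (component l) k (bar (component l) (zeta l)) (zetaInv l))
    {f : gradedDual (component l)} (hf : f ∈ oddIdeal (component l) k (zetaUnit l)) :
    ∀ x ∈ C, f.1 x = 0 := by
  refine TwoSidedIdeal.span_induction (p := fun f _ => ∀ x ∈ C, f.1 x = 0) ?_ ?_ ?_ ?_ ?_ ?_ hf
  · rintro _ ⟨n, hn, rfl⟩ x hx
    -- A generator evaluates `ζ̄ - ζ⁻¹` at the degree `n` part of `x`, which stays in `C` because
    -- `C` is homogeneous.
    refine sub_eq_zero.2 (hC.2 (proj (component l) n x) ⟨hC.1.homogeneous n hx, ?_⟩)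
    exact (le_iSup₂_of_le n hn le_rfl : component l n ≤ initialPart (component l) k)
      (Subtype.mem _)
  · intro x _
    rfl
  · intro f g _ _ hf hg x hx
    exact (congrArg₂ (· + ·) (hf x hx) (hg x hx)).trans (add_zero 0)
  · intro f _ hf x hx
    exact (congrArg Neg.neg (hf x hx)).trans neg_zero
  · intro a f _ hf x hx
    exact convMul_apply_eq_zero hC.1 (f := a.1) (g := f.1) (Or.inr hf) hx
  · intro a f _ hf x hx
    exact convMul_apply_eq_zero hC.1 (f := f.1) (g := a.1) (Or.inl hf) hx

/-- The span of the `η_I` all of whose columns satisfy `P` is a graded subcoalgebra. -/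
theorem isGradedSubcoalgebra_span_eta (P : {n : Fin l → ℕ // n ≠ 0} → Prop) :
    IsGradedSubcoalgebra (component l)
      (Submodule.span ℚ {f | ∃ I : VecComp l, (∀ i ∈ I, P i) ∧ f = eta I}) where
  homogeneous n h hh := by
    refine Submodule.span_le (p := (Submodule.span ℚ
      {f | ∃ I : VecComp l, (∀ i ∈ I, P i) ∧ f = eta I}).comap (proj (component l) n)).2 ?_ hh
    rintro _ ⟨I, hI, rfl⟩
    rw [SetLike.mem_coe, Submodule.mem_comap]
    rcases eq_or_ne (colSum I) n with h | h
    · rw [proj_same _ (h ▸ eta_mem_component I)]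
      exact Submodule.subset_span ⟨I, hI, rfl⟩
    · rw [proj_ne _ (eta_mem_component I) h]
      exact Submodule.zero_mem _
  comul_mem h hh := by
    set C := Submodule.span ℚ {f | ∃ I : VecComp l, (∀ i ∈ I, P i) ∧ f = eta I} with hC
    refine Submodule.span_le (p := (LinearMap.range (TensorProduct.map C.subtype C.subtype)).comap
      (comul (R := ℚ))).2 ?_ hh
    rintro _ ⟨I, hI, rfl⟩
    rw [SetLike.mem_coe, Submodule.mem_comap, comul_eta]
    refine Submodule.sum_mem _ fun i _ => ?_
    exact ⟨⟨eta (I.take i), Submodule.subset_span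
        ⟨_, fun j hj => hI j (List.mem_of_mem_take hj), rfl⟩⟩ ⊗ₜ
      ⟨eta (I.drop i), Submodule.subset_span
        ⟨_, fun j hj => hI j (List.mem_of_mem_drop hj), rfl⟩⟩, rfl⟩

theorem span_eta_mem_agreeing (k : Fin l → ℕ∞) :
    Submodule.span ℚ {f | ∃ I : VecComp l,
        (∀ i ∈ I, LeExt i.1 k → Odd (weight i.1)) ∧ f = eta I} ∈
      agreeing (component l) k (bar (component l) (zeta l)) (zetaInv l) := by
  classical
  refine ⟨isGradedSubcoalgebra_span_eta fun i => LeExt i.1 k → Odd (weight i.1), ?_⟩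
  rintro h ⟨hh, hk⟩
  -- Agreement can be tested degree by degree. In degree `n ≤ k` every column of `I` is `≤ n ≤ k`,
  -- so the condition on `I` makes all of them odd.
  have h1 : ∀ n, LeExt n k → bar (component l) (zeta l) (proj (component l) n h) =
      zetaInv l (proj (component l) n h) := by
    intro n hn
    rw [← sub_eq_zero]
    refine Submodule.span_le (p := LinearMap.ker (((bar (component l) (zeta l)).ofConv -
      (zetaInv l).ofConv) ∘ₗ proj (component l) n)).2 ?_ hh
    rintro _ ⟨I, hI, rfl⟩
    rw [SetLike.mem_coe, LinearMap.mem_ker, LinearMap.comp_apply]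
    rcases eq_or_ne (colSum I) n with h | h
    · rw [proj_same _ (h ▸ eta_mem_component I), LinearMap.sub_apply, sub_eq_zero]
      exact bar_zeta_eta_eq fun i hi => hI i hi (leExt_of_le (h ▸ le_colSum_of_mem hi) hn)
    · rw [proj_ne _ (eta_mem_component I) h, map_zero]
  have h2 : ∀ n, ¬ LeExt n k → proj (component l) n h = 0 := by
    intro n hn
    have : initialPart (component l) k ≤ LinearMap.ker (proj (component l) n) := by
      refine iSup₂_le fun m hm x hx => proj_ne (component l) hx ?_
      rintro rfl
      exact hn hm
    exact this hk
  rw [← DirectSum.sum_support_decompose (component l) h, map_sum, map_sum]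
  refine Finset.sum_congr rfl fun n _ => ?_
  rw [← proj_apply]
  by_cases hn : LeExt n k
  · exact h1 n hn
  · rw [h2 n hn, map_zero, map_zero]

theorem oddSubalgebra_eq_span (k : Fin l → ℕ∞) :
    oddSubalgebra (component l) k (zetaUnit l) =
      Submodule.span ℚ {f | ∃ I : VecComp l,
        (∀ i ∈ I, LeExt i.1 k → Odd (weight i.1)) ∧ f = eta I} := by
  refine le_antisymm (sSup_le fun C hC h hh => ?_) (le_sSup (span_eta_mem_agreeing k))
  rw [← (etaBasis l).linearCombination_repr h, Finsupp.linearCombination_apply]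
  refine Submodule.sum_mem _ fun I hI => Submodule.smul_mem _ _ (Submodule.subset_span
    ⟨I, fun i hi hk => ?_, etaBasis_apply I⟩)
  -- The `I`-th coordinate of `h` is `Υ^I(h)`. An even column `≤ k` puts `Υ^I` into the odd ideal,
  -- which vanishes on `C`.
  by_contra hodd
  refine Finsupp.mem_support_iff.1 hI (apply_eq_zero_of_mem_oddIdeal hC (f := upsilon I) ?_ h hh)
  exact upsilon_mem_of_mem hi (upsilon_mem_oddIdeal i hk (Nat.not_odd_iff_even.1 hodd))

end LevelQSym

end

theorem theoremT (l : ℕ) (k : Fin l → ℕ∞) :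
    Multigraded.oddIdeal (LevelQSym.component l) k (LevelQSym.zetaUnit l) =
        TwoSidedIdeal.span {y | ∃ (n : Fin l → ℕ) (hn : n ≠ 0), Multigraded.LeExt n k ∧
          Even (Multigraded.weight n) ∧ y = LevelQSym.upsilon [⟨n, hn⟩]} ∧
      Multigraded.oddSubalgebra (LevelQSym.component l) k (LevelQSym.zetaUnit l) =
        Submodule.span ℚ {f | ∃ I : LevelQSym.VecComp l,
          (∀ i ∈ I, Multigraded.LeExt i.1 k → Odd (Multigraded.weight i.1)) ∧
            f = LevelQSym.eta I} := by
  exact ⟨LevelQSym.oddIdeal_eq_span k, LevelQSym.oddSubalgebra_eq_span k⟩
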